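/- For $n \ge 2$ let $\mathfrak{sl}_n$ be the Lie algebra of traceless complex $n \times n$ matrices with the commutator bracket. For $k \ge 2$ let $T^{(k)}_{\mathfrak{sl}_n} \in \mathfrak{sl}_n \otimes (\mathfrak{sl}_n^*)^{\otimes k}$ be the tensor of order $k+1$ corresponding to the $k$-fold iterated bracket, that is, the multilinear map $$(X_1, \dots, X_k) \mapsto [\cdots[[X_1, X_2], X_3], \cdots, X_k].$$ For a tensor $T \in V_1 \otimes \cdots \otimes V_m$ on finite-dimensional complex vector spaces, let $\mathbf{u}_m(q) = \sum_{i=1}^q e_i \otimes \cdots \otimes e_i \in (\mathbb{C}^q)^{\otimes m}$. The subrank $\mathrm{Q}(T)$ is the largest $q$ such that $\mathbf{u}_m(q) = (X_1 \otimes \cdots \otimes X_m) T$ for some linear maps $X_i : V_i \to \mathbb{C}^q$. The border subrank $\underline{\mathrm{Q}}(T)$ is the largest $q$ such that $\mathbf{u}_m(q)$ lies in the closure, in $(\mathbb{C}^q)^{\otimes m}$ with the Euclidean topology, of the set of all tensors $(X_1 \otimes \cdots \otimes X_m) T$ with linear maps $X_i : V_i \to \mathbb{C}^q$. Theorem. (1)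 For every $n \ge 2$, $$n \le \mathrm{Q}(T^{(2)}_{\mathfrak{sl}_n}) \le \underline{\mathrm{Q}}(T^{(2)}_{\mathfrak{sl}_n}) \le n^2 - n.$$ (2) For every $k \ge 2$, $\underline{\mathrm{Q}}(T^{(k)}_{\mathfrak{sl}_2}) = 2$. -/

import Mathlib

open scoped TensorProduct BigOperators

noncomputable section

namespace TensorSubrank

section Tensors

variable {ι : Type*} {V W : ι → Type*}
  [∀ i, AddCommGroup (V i)] [∀ i, Module ℂ (V i)]
  [∀ i, AddCommGroup (W i)] [∀ i, Module ℂ (W i)]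

/-- `T ∈ ⨂ V i` restricts to `T' ∈ ⨂ W i` if `T' = (⨂ X i) T` for some linear maps
`X i : V i → W i`. (Since the factors of `T` and `T'` may be different spaces, the maps go from
`V i` to `W i`; this is the same as re-embedding both factors in a larger space and using
endomorphisms of the larger space.) -/
def Restricts (T : ⨂[ℂ] i, V i) (T' : ⨂[ℂ] i, W i) : Prop :=
  ∃ X : (i : ι) → V i →ₗ[ℂ] W i, PiTensorProduct.map X T = T'

/-- `T` degenerates to `T'` if `T'` lies in the closure of the set of restrictions of `T` to the
tensor space of `T'`. The closure is taken in the Euclidean topology, which on a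
finite-dimensional complex vector space is the module topology. -/
def Degenerates (T : ⨂[ℂ] i, V i) (T' : ⨂[ℂ] i, W i) : Prop :=
  T' ∈ @closure (⨂[ℂ] i, W i) (moduleTopology ℂ (⨂[ℂ] i, W i)) {S | Restricts T S}

variable (ι) in
/-- The unit tensor `∑_{j < q} e_j ⊗ ⋯ ⊗ e_j`, with factors indexed by `ι`. -/
def unitTensor (q : ℕ) : ⨂[ℂ] _i : ι, (Fin q → ℂ) :=
  ∑ j : Fin q, PiTensorProduct.tprod ℂ fun _ : ι => (Pi.single j 1 : Fin q → ℂ)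

/-- The subrank: the largest `q` such that `T` restricts to the unit tensor of size `q`
(`⊤` if there are arbitrarily large such `q`). -/
def subrank (T : ⨂[ℂ] i, V i) : ℕ∞ :=
  ⨆ q ∈ {q : ℕ | Restricts T (unitTensor ι q)}, (q : ℕ∞)

/-- The border subrank: the largest `q` such that `T` degenerates to the unit tensor of size `q`
(`⊤` if there are arbitrarily large such `q`). -/
def borderSubrank (T : ⨂[ℂ] i, V i) : ℕ∞ :=
  ⨆ q ∈ {q : ℕ | Degenerates T (unitTensor ι q)}, (q : ℕ∞)

end Tensors

section StructureTensors

variable (A : Type*) [AddCommGroup A] [Module ℂ A]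

/-- The factors of `A ⊗ A* ⊗ ⋯ ⊗ A*`, with `k` copies of the dual space. -/
def Factor (k : ℕ) : Fin (k + 1) → Type _ :=
  Fin.cases A fun _ => Module.Dual ℂ A

instance instAddCommGroupFactor (k : ℕ) : (i : Fin (k + 1)) → AddCommGroup (Factor A k i) :=
  Fin.cases (inferInstanceAs (AddCommGroup A))
    fun _ => inferInstanceAs (AddCommGroup (Module.Dual ℂ A))

instance instModuleFactor (k : ℕ) : (i : Fin (k + 1)) → Module ℂ (Factor A k i) :=
  Fin.cases (inferInstanceAs (Module ℂ A))
    fun _ => inferInstanceAs (Module ℂ (Module.Dual ℂ A))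

variable {A}

/-- The family `(a, α 0, …, α (k - 1))` of one vector and `k` linear forms. -/
def factorCons {k : ℕ} (a : A) (α : Fin k → Module.Dual ℂ A) : (i : Fin (k + 1)) → Factor A k i :=
  Fin.cases a α

/-- The `k`-fold product, bracketed from the left, `(⋯((a₁ a₂) a₃)⋯) a_k`, of a bilinear
multiplication on `A`. It is meant for `k ≥ 1`; there is no empty product, so `k = 0` gives `0`. -/
def iteratedProduct (mul : A →ₗ[ℂ] A →ₗ[ℂ] A) :
    (k : ℕ) → MultilinearMap ℂ (fun _ : Fin k => A) A
  | 0 => 0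
  | 1 => MultilinearMap.ofSubsingleton ℂ A A 0 LinearMap.id
  | k + 2 => (mul.compMultilinearMap (iteratedProduct mul (k + 1))).uncurryRight

/-- The tensor in `A ⊗ A* ⊗ ⋯ ⊗ A*` of a multilinear map `m : A × ⋯ × A → A`, written in a basis
`b` of `A` as `∑ m(b_{f 1}, …, b_{f k}) ⊗ b*_{f 1} ⊗ ⋯ ⊗ b*_{f k}`. By `pairing_tensorOf` it does
not depend on the basis. -/
def tensorOf [FiniteDimensional ℂ A] {k : ℕ} (m : MultilinearMap ℂ (fun _ : Fin k => A) A) :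
    ⨂[ℂ] i, Factor A k i :=
  ∑ f : Fin k → Fin (Module.finrank ℂ A),
    PiTensorProduct.tprod ℂ
      (factorCons (m fun l => Module.finBasis ℂ A (f l))
        fun l => (Module.finBasis ℂ A).coord (f l))

/-- The linear form on `A` or on `A*` given by `φ ∈ A*`, respectively by evaluation at `x l`. -/
def factorForm {k : ℕ} (φ : Module.Dual ℂ A) (x : Fin k → A) :
    (i : Fin (k + 1)) → Factor A k i →ₗ[ℂ] ℂ :=
  Fin.cases φ fun l => Module.Dual.eval ℂ A (x l)

/-- Contracting `tensorOf m` with `φ ∈ A*` and `x₁, …, x_k ∈ A` gives `φ (m (x₁, …, x_k))`: so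
`tensorOf m` is the tensor that corresponds to `m`. -/
theorem pairing_tensorOf [FiniteDimensional ℂ A] {k : ℕ}
    (m : MultilinearMap ℂ (fun _ : Fin k => A) A) (φ : Module.Dual ℂ A) (x : Fin k → A) :
    PiTensorProduct.lift
        ((MultilinearMap.mkPiAlgebra ℂ (Fin (k + 1)) ℂ).compLinearMap (factorForm φ x))
        (tensorOf m) = φ (m x) := by
  have hx : x = fun l => ∑ j, (Module.finBasis ℂ A).coord j (x l) • Module.finBasis ℂ A j := by
    funext l
    exact ((Module.finBasis ℂ A).sum_repr (x l)).symm
  conv_rhs => rw [hx, MultilinearMap.map_sum]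
  simp only [tensorOf, map_sum, PiTensorProduct.lift.tprod, MultilinearMap.compLinearMap_apply,
    MultilinearMap.mkPiAlgebra_apply, MultilinearMap.map_smul_univ, map_smul, smul_eq_mul,
    Fin.prod_univ_succ]
  refine Finset.sum_congr rfl fun f _ => ?_
  rw [mul_comm]
  rfl

/-- The `k`-th structure tensor, of order `k + 1`, of a Lie algebra `L`: the tensor of the
iterated bracket `(X₁, …, X_k) ↦ [⋯[[X₁, X₂], X₃], ⋯, X_k]`. -/
def lieStructureTensor (L : Type*) [LieRing L] [LieAlgebra ℂ L] [FiniteDimensional ℂ L] (k : ℕ) :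
    ⨂[ℂ] i, Factor L k i :=
  tensorOf (iteratedProduct (LieAlgebra.ad ℂ L : L →ₗ[ℂ] L →ₗ[ℂ] L) k)

end StructureTensors

section SpecialLinear

attribute [local instance 100] LieRing.ofAssociativeRing

/-- The Lie algebra `𝔰𝔩_n` of traceless complex `n × n` matrices with the commutator bracket. -/
abbrev SL (n : ℕ) : Type := LieAlgebra.SpecialLinear.sl (Fin n) ℂ

instance instFiniteDimensionalSL (n : ℕ) : FiniteDimensional ℂ (SL n) :=
  inferInstanceAs
    (FiniteDimensional ℂ (LieAlgebra.SpecialLinear.sl (Fin n) ℂ).toSubmodule)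

end SpecialLinear

end TensorSubrank

end

open scoped TensorProduct BigOperators

noncomputable section

namespace TensorSubrank

/-! Upper bound, for every `k ≥ 2`: summing over the indices of all dual slots but the last turns a
restriction of the tensor into the matrix `φ i [z, y j]`, where `z` is an iterated bracket. Every
centralizer in `𝔤𝔩_n` has dimension at least `n`, so `ad z` has rank at most `n ^ 2 - n`, and the
determinant vanishes once `q > n ^ 2 - n`. Vanishing is a closed condition, and the unit tensor
yields the identity matrix (`not_degenerates_of_det_eq_zero`, `det_commutator_eq_zero`).

Lower bound `n` for `k = 2`: explicit elementary matrices (`restricts_lieStructureTensor_sl`).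

Lower bound `2` for `𝔰𝔩_2`: by induction on the number of slots, an array of iterated brackets tends
to one supported on the two constant multi-indices, with values `e` and alternately `f` or `h`. Each
new slot creates at most one unwanted entry, which a rescaling sends to zero
(`diagonalValues_mem_closure_succ`). -/

/-- The contraction of a tensor with one linear form on each factor. -/
def contraction {ι : Type*} [Fintype ι] {W : ι → Type*} [∀ i, AddCommGroup (W i)]
    [∀ i, Module ℂ (W i)] (ψ : ∀ i, W i →ₗ[ℂ] ℂ) : (⨂[ℂ] i, W i) →ₗ[ℂ] ℂ :=
  PiTensorProduct.lift ((MultilinearMap.mkPiAlgebra ℂ ι ℂ).compLinearMap ψ)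

theorem contraction_tprod {ι : Type*} [Fintype ι] {W : ι → Type*} [∀ i, AddCommGroup (W i)]
    [∀ i, Module ℂ (W i)] (ψ : ∀ i, W i →ₗ[ℂ] ℂ) (w : ∀ i, W i) :
    contraction ψ (PiTensorProduct.tprod ℂ w) = ∏ i, ψ i (w i) := by
  simp [contraction]

theorem contraction_map {ι : Type*} [Fintype ι] {V W : ι → Type*} [∀ i, AddCommGroup (V i)]
    [∀ i, Module ℂ (V i)] [∀ i, AddCommGroup (W i)] [∀ i, Module ℂ (W i)]
    (ψ : ∀ i, W i →ₗ[ℂ] ℂ) (X : ∀ i, V i →ₗ[ℂ] W i) (T : ⨂[ℂ] i, V i) :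
    contraction ψ (PiTensorProduct.map X T) = contraction (fun i => ψ i ∘ₗ X i) T := by
  have h : contraction ψ ∘ₗ PiTensorProduct.map X = contraction (fun i => ψ i ∘ₗ X i) := by
    ext w
    simp [contraction_tprod]
  exact LinearMap.congr_fun h T

theorem contraction_unitTensor {ι : Type*} [Fintype ι] {q : ℕ}
    (ψ : ι → (Fin q → ℂ) →ₗ[ℂ] ℂ) :
    contraction ψ (unitTensor ι q) = ∑ j, ∏ i, ψ i (Pi.single j 1) := by
  simp [unitTensor, contraction_tprod]

theorem ext_contraction {ι : Type*} [Fintype ι] {q : ℕ} {S S' : ⨂[ℂ] _i : ι, (Fin q → ℂ)}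
    (h : ∀ J : ι → Fin q, contraction (fun i => LinearMap.proj (J i)) S =
      contraction (fun i => LinearMap.proj (J i)) S') : S = S' := by
  have key (J : ι → Fin q) (S : ⨂[ℂ] _i : ι, (Fin q → ℂ)) :
      (Basis.piTensorProduct fun _ : ι => Pi.basisFun ℂ (Fin q)).repr S J =
        contraction (fun i => LinearMap.proj (J i)) S := by
    have : (Finsupp.lapply J) ∘ₗ
        (Basis.piTensorProduct fun _ : ι => Pi.basisFun ℂ (Fin q)).repr.toLinearMap =
        contraction (fun i => LinearMap.proj (J i)) := by
      ext w
      simp [contraction_tprod]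
    exact LinearMap.congr_fun this S
  refine (Basis.piTensorProduct fun _ : ι => Pi.basisFun ℂ (Fin q)).repr.injective ?_
  ext J
  rw [key, key, h]

/-! ### Coordinates of restrictions of structure tensors, and the determinantal obstruction -/

section

variable {A : Type*} [AddCommGroup A] [Module ℂ A]

theorem contraction_tensorOf [FiniteDimensional ℂ A] {k : ℕ} (m : MultilinearMap ℂ (fun _ : Fin k => A) A)
    (ψ : ∀ i, Factor A k i →ₗ[ℂ] ℂ) :
    contraction ψ (tensorOf m) =
      (ψ 0 : Module.Dual ℂ A) (m fun l => (Module.evalEquiv ℂ A).symm (ψ l.succ)) := by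
  have h : ψ = factorForm (ψ 0) fun l => (Module.evalEquiv ℂ A).symm (ψ l.succ) := by
    funext i
    refine Fin.cases rfl (fun l => ?_) i
    exact ((Module.evalEquiv ℂ A).apply_symm_apply (ψ l.succ)).symm
  conv_lhs => rw [h]
  exact pairing_tensorOf m _ _

/-- The linear maps on the factors of `A ⊗ A* ⊗ ⋯ ⊗ A*` with coordinates `φ i` and evaluation at
`x l j`. -/
def factorMaps {k q : ℕ} (φ : Fin q → Module.Dual ℂ A) (x : Fin k → Fin q → A) :
    (i : Fin (k + 1)) → Factor A k i →ₗ[ℂ] (Fin q → ℂ) :=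
  Fin.cases (LinearMap.pi φ) fun l => LinearMap.pi fun j => Module.Dual.eval ℂ A (x l j)

theorem contraction_map_factorMaps [FiniteDimensional ℂ A] {k q : ℕ} (m : MultilinearMap ℂ (fun _ : Fin k => A) A)
    (φ : Fin q → Module.Dual ℂ A) (x : Fin k → Fin q → A) (J : Fin (k + 1) → Fin q) :
    contraction (fun i => LinearMap.proj (J i))
        (PiTensorProduct.map (factorMaps φ x) (tensorOf m)) =
      φ (J 0) (m fun l => x l (J l.succ)) := by
  have h : (fun i => LinearMap.proj (J i) ∘ₗ factorMaps φ x i) =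
      factorForm (φ (J 0)) fun l => x l (J l.succ) := by
    funext i
    exact Fin.cases rfl (fun l => rfl) i
  rw [contraction_map, h]
  exact pairing_tensorOf m _ _

theorem contraction_proj_unitTensor {k q : ℕ} (J : Fin (k + 1) → Fin q) :
    contraction (fun i => LinearMap.proj (J i)) (unitTensor (Fin (k + 1)) q) =
      if ∀ l : Fin k, J l.succ = J 0 then 1 else 0 := by
  rw [contraction_unitTensor]
  simp only [LinearMap.proj_apply, Pi.single_apply, Fintype.prod_ite_zero, Finset.prod_const_one]
  split_ifs with h
  · rw [Finset.sum_eq_single (J 0)]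
    · rw [if_pos]
      exact fun i => Fin.cases rfl h i
    · intro j _ hj
      exact if_neg fun h' => hj (h' 0).symm
    · simp
  · refine Finset.sum_eq_zero fun j _ => if_neg fun h' => h fun l => ?_
    rw [h', h']

theorem restricts_unitTensor [FiniteDimensional ℂ A] {k q : ℕ} (m : MultilinearMap ℂ (fun _ : Fin k => A) A)
    (φ : Fin q → Module.Dual ℂ A) (x : Fin k → Fin q → A)
    (h : ∀ i (j : Fin k → Fin q), φ i (m fun l => x l (j l)) = if ∀ l, j l = i then 1 else 0) :
    Restricts (tensorOf m) (unitTensor (Fin (k + 1)) q) := by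
  refine ⟨factorMaps φ x, ext_contraction fun J => ?_⟩
  rw [contraction_map_factorMaps, contraction_proj_unitTensor]
  exact h (J 0) fun l => J l.succ

/-- The tensor with coordinates `φ i (Z j)`, as a linear function of `Z`. -/
def tensorOfValues {k q : ℕ} (φ : Fin q → Module.Dual ℂ A) :
    ((Fin k → Fin q) → A) →ₗ[ℂ] ⨂[ℂ] _i : Fin (k + 1), (Fin q → ℂ) :=
  ∑ J : Fin (k + 1) → Fin q,
    ((φ (J 0)) ∘ₗ LinearMap.proj fun l => J l.succ).smulRight
      (PiTensorProduct.tprod ℂ fun i => (Pi.single (J i) 1 : Fin q → ℂ))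

theorem contraction_tensorOfValues {k q : ℕ} (φ : Fin q → Module.Dual ℂ A)
    (Z : (Fin k → Fin q) → A) (J : Fin (k + 1) → Fin q) :
    contraction (fun i => LinearMap.proj (J i)) (tensorOfValues φ Z) =
      φ (J 0) (Z fun l => J l.succ) := by
  simp only [tensorOfValues, LinearMap.sum_apply, LinearMap.smulRight_apply, map_sum, map_smul,
    contraction_tprod, LinearMap.proj_apply, Pi.single_apply, Fintype.prod_ite_zero,
    Finset.prod_const_one, LinearMap.comp_apply, smul_eq_mul]
  rw [Finset.sum_eq_single J]
  · simp
  · intro J' _ hJ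
    rw [if_neg fun h => hJ (funext fun i => (h i).symm), mul_zero]
  · simp

/-- The values of a multilinear map on `k` families of `q` vectors. -/
def valueSet {k : ℕ} (q : ℕ) (m : MultilinearMap ℂ (fun _ : Fin k => A) A) :
    Set ((Fin k → Fin q) → A) :=
  Set.range fun (x : Fin k → Fin q → A) j => m fun l => x l (j l)

/-- With the forms `φ` fixed, the tensor depends linearly, hence continuously, on the array of
values, so limits may be taken among arrays in `A`. -/
theorem degenerates_unitTensor [FiniteDimensional ℂ A] [TopologicalSpace A] [IsModuleTopology ℂ A] {k q : ℕ}
    (m : MultilinearMap ℂ (fun _ : Fin k => A) A) (φ : Fin q → Module.Dual ℂ A)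
    {Z : (Fin k → Fin q) → A} (hZ : Z ∈ closure (valueSet q m))
    (h : ∀ i (j : Fin k → Fin q), φ i (Z j) = if ∀ l, j l = i then 1 else 0) :
    Degenerates (tensorOf m) (unitTensor (Fin (k + 1)) q) := by
  let _ : TopologicalSpace (⨂[ℂ] _i : Fin (k + 1), (Fin q → ℂ)) := moduleTopology ℂ _
  have : IsModuleTopology ℂ (⨂[ℂ] _i : Fin (k + 1), (Fin q → ℂ)) := ⟨rfl⟩
  have : ContinuousAdd (⨂[ℂ] _i : Fin (k + 1), (Fin q → ℂ)) :=
    IsModuleTopology.toContinuousAdd ℂ _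
  have hu : tensorOfValues φ Z = unitTensor (Fin (k + 1)) q := ext_contraction fun J => by
    rw [contraction_tensorOfValues, contraction_proj_unitTensor, h]
  have hc : Continuous (tensorOfValues (k := k) φ) := IsModuleTopology.continuous_of_linearMap _
  change unitTensor (Fin (k + 1)) q ∈ closure _
  rw [← hu]
  refine map_mem_closure hc hZ ?_
  rintro _ ⟨x, rfl⟩
  refine ⟨factorMaps φ x, ext_contraction fun J => ?_⟩
  rw [contraction_map_factorMaps, contraction_tensorOfValues]

/-- If all left multiplications `mul z` have singular `q × q` compressions, then the tensor of the
iterated product does not degenerate to the unit tensor of size `q`. -/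
theorem not_degenerates_of_det_eq_zero [FiniteDimensional ℂ A] (mul : A →ₗ[ℂ] A →ₗ[ℂ] A) {k q : ℕ} (hk : 2 ≤ k)
    (h : ∀ (z : A) (φ : Fin q → Module.Dual ℂ A) (y : Fin q → A),
      (Matrix.of fun i j => φ i (mul z (y j))).det = 0) :
    ¬ Degenerates (tensorOf (iteratedProduct mul k)) (unitTensor (Fin (k + 1)) q) := by
  obtain ⟨k, rfl⟩ := Nat.exists_eq_add_of_le' hk
  intro hd
  let _ : TopologicalSpace (⨂[ℂ] _i : Fin (k + 2 + 1), (Fin q → ℂ)) := moduleTopology ℂ _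
  have : IsModuleTopology ℂ (⨂[ℂ] _i : Fin (k + 2 + 1), (Fin q → ℂ)) := ⟨rfl⟩
  -- The middle slots get the all-ones form, which is `1` on every basis vector; this is why the
  -- unit tensor contracts to the identity matrix.
  let ψ (i j : Fin q) : Fin (k + 2 + 1) → (Fin q → ℂ) →ₗ[ℂ] ℂ :=
    Fin.cases (LinearMap.proj i) fun l => Fin.lastCases (LinearMap.proj j)
      (fun _ => ∑ p, LinearMap.proj p) l
  have hψ (i j : Fin q) (l : Fin (k + 1)) : ψ i j l.castSucc.succ = ∑ p, LinearMap.proj p :=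
    Fin.lastCases_castSucc (motive := fun _ => (Fin q → ℂ) →ₗ[ℂ] ℂ) l
  have hψ' (i j : Fin q) : ψ i j (Fin.last (k + 1)).succ = LinearMap.proj j :=
    Fin.lastCases_last (motive := fun _ => (Fin q → ℂ) →ₗ[ℂ] ℂ)
  have hψ'' (i j : Fin q) : ψ i j 0 = LinearMap.proj i := rfl
  let M : (⨂[ℂ] _i : Fin (k + 2 + 1), (Fin q → ℂ)) → Matrix (Fin q) (Fin q) ℂ :=
    fun S => Matrix.of fun i j => contraction (ψ i j) S
  have hM : Continuous M := continuous_matrix fun i j =>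
    IsModuleTopology.continuous_of_linearMap (contraction (ψ i j))
  have hclosed : IsClosed {S | (M S).det = 0} := isClosed_eq hM.matrix_det continuous_const
  have hmem : (M (unitTensor (Fin (k + 2 + 1)) q)).det = 0 := by
    refine closure_minimal ?_ hclosed hd
    rintro _ ⟨X, rfl⟩
    let y (j : Fin q) : A := (Module.evalEquiv ℂ A).symm
      (LinearMap.proj j ∘ₗ X (Fin.last (k + 1)).succ)
    let w (l : Fin (k + 1)) : A := (Module.evalEquiv ℂ A).symm
      ((∑ p, LinearMap.proj p) ∘ₗ X l.castSucc.succ)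
    have hX := h (iteratedProduct mul (k + 1) w) (fun i => LinearMap.proj i ∘ₗ X 0) y
    refine Eq.trans (congrArg Matrix.det ?_) hX
    ext i j
    change contraction (ψ i j) (PiTensorProduct.map X (tensorOf _)) = _
    rw [contraction_map, contraction_tensorOf]
    refine congrArg (LinearMap.proj i ∘ₗ X 0 : Module.Dual ℂ A) ?_
    change mul (iteratedProduct mul (k + 1) _) _ = mul (iteratedProduct mul (k + 1) w) (y j)
    congr 2
    · congr 1
      funext l
      refine congrArg (Module.evalEquiv ℂ A).symm ?_
      exact congrArg (fun f => f ∘ₗ X l.castSucc.succ) (hψ i j l)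
    · refine congrArg (Module.evalEquiv ℂ A).symm ?_
      exact congrArg (fun f => f ∘ₗ X (Fin.last (k + 1)).succ) (hψ' i j)
  have hone : M (unitTensor (Fin (k + 2 + 1)) q) = 1 := by
    ext i j
    change contraction (ψ i j) _ = _
    rw [contraction_unitTensor, Matrix.one_apply]
    have hp (p : Fin q) : ∏ l, ψ i j l (Pi.single p 1) =
        (if p = i then 1 else 0) * (if p = j then 1 else 0) := by
      rw [Fin.prod_univ_succ, Fin.prod_univ_castSucc]
      simp only [hψ, hψ', hψ'']
      simp [Pi.single_apply, eq_comm]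
    simp [hp, eq_comm]
  rw [hone, Matrix.det_one] at hmem
  exact one_ne_zero hmem

end

theorem subrank_le_borderSubrank {ι : Type*} {V : ι → Type*} [∀ i, AddCommGroup (V i)]
    [∀ i, Module ℂ (V i)] (T : ⨂[ℂ] i, V i) : subrank T ≤ borderSubrank T :=
  biSup_mono fun _ hq => @subset_closure _ (moduleTopology ℂ _) _ _ hq

/-! ### Rank of the commutator map on all `n × n` matrices -/

section Commutator

open Polynomial

/-- If the Krylov vectors of `z` at `v` are independent, the centralizer of `z` has dimension at
least `n`. -/
theorem finrank_range_commutator_le {K : Type*} [Field K] {n : ℕ} (z : Matrix (Fin n) (Fin n) K)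
    (v : Fin n → K)
    (h : (Matrix.of fun i j : Fin n => ((z ^ (j : ℕ)).mulVec v) i).det ≠ 0) :
    Module.finrank K (LinearMap.range (LinearMap.mulLeft K z - LinearMap.mulRight K z)) ≤
      n ^ 2 - n := by
  set f := LinearMap.mulLeft K z - LinearMap.mulRight K z
  -- Powers of `z` commute with `z`; they are independent because their images at `v` are.
  have hpow : ∀ j : Fin n, z ^ (j : ℕ) ∈ LinearMap.ker f := fun j => by
    simp [f, LinearMap.mem_ker, ← pow_succ, ← pow_succ']
  have hli : LinearIndependent K fun j : Fin n => (⟨z ^ (j : ℕ), hpow j⟩ : LinearMap.ker f) := by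
    refine LinearIndependent.of_comp
      ((Matrix.mulVecBilin K K).flip v ∘ₗ (LinearMap.ker f).subtype) ?_
    have := Matrix.linearIndependent_cols_of_det_ne_zero h
    exact this
  have h1 := hli.fintype_card_le_finrank
  have h2 := f.finrank_range_add_finrank_ker
  rw [Module.finrank_matrix, Module.finrank_self, Fintype.card_fin, mul_one, ← pow_two] at h2
  rw [Fintype.card_fin] at h1
  omega

theorem det_eq_zero_of_finrank_range_lt {K V : Type*} [Field K] [AddCommGroup V] [Module K V]
    [FiniteDimensional K V] {q : ℕ} (f : V →ₗ[K] V)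
    (hf : Module.finrank K (LinearMap.range f) < q)
    (φ : Fin q → V →ₗ[K] K) (y : Fin q → V) : (Matrix.of fun i j => φ i (f (y j))).det = 0 := by
  by_contra hdet
  have hli : LinearIndependent K fun j => (⟨f (y j), y j, rfl⟩ : LinearMap.range f) :=
    LinearIndependent.of_comp (LinearMap.pi φ ∘ₗ (LinearMap.range f).subtype)
      (Matrix.linearIndependent_cols_of_det_ne_zero hdet)
  have := hli.fintype_card_le_finrank
  rw [Fintype.card_fin] at this
  omega

/-- The centralizer bound needs a cyclic vector, which `z` may lack. On the line `g` from `z` to a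
diagonal `d`, let `P` be the determinant in question and `Q` the Krylov determinant at the all-ones
vector. At each point one of them vanishes, so `P * Q = 0`; since `Q ≠ 0`, `P` vanishes identically,
in particular at `t = 0`. -/
theorem det_commutator_eq_zero {n q : ℕ} (hq : n ^ 2 - n < q) (z : Matrix (Fin n) (Fin n) ℂ)
    (φ : Fin q → Matrix (Fin n) (Fin n) ℂ →ₗ[ℂ] ℂ) (y : Fin q → Matrix (Fin n) (Fin n) ℂ) :
    (Matrix.of fun i j => φ i (z * y j - y j * z)).det = 0 := by
  -- Distinct diagonal entries make the Krylov matrix of `d` a nonsingular Vandermonde matrix.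
  let d : Matrix (Fin n) (Fin n) ℂ := Matrix.diagonal fun i => ((i : ℕ) : ℂ)
  let g (t : ℂ) := z + t • (d - z)
  let G : Matrix (Fin n) (Fin n) ℂ[X] := Matrix.of fun i j => C (z i j) + X * C ((d - z) i j)
  let P : ℂ[X] := (Matrix.of fun i j => C (φ i (z * y j - y j * z)) +
    X * C (φ i ((d - z) * y j - y j * (d - z)))).det
  let Q : ℂ[X] := (Matrix.of fun i j : Fin n => ((G ^ (j : ℕ)).mulVec fun _ => 1) i).det
  have hG (t : ℂ) : (evalRingHom t).mapMatrix G = g t := by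
    ext i j
    simp [G, g]
  have hQ (t : ℂ) : Q.eval t =
      (Matrix.of fun i j : Fin n => ((g t ^ (j : ℕ)).mulVec fun _ => 1) i).det := by
    change evalRingHom t Q = _
    rw [RingHom.map_det]
    congr 1
    ext i j
    have hpow : g t ^ (j : ℕ) = (evalRingHom t).mapMatrix (G ^ (j : ℕ)) := by rw [map_pow, hG]
    rw [Matrix.of_apply, hpow]
    simp [Matrix.mulVec, dotProduct, eval_finsetSum]
  have hP (t : ℂ) : P.eval t = (Matrix.of fun i j => φ i (g t * y j - y j * g t)).det := by
    change evalRingHom t P = _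
    rw [RingHom.map_det]
    congr 1
    ext i j
    have : g t * y j - y j * g t =
        (z * y j - y j * z) + t • ((d - z) * y j - y j * (d - z)) := by
      rw [add_mul, mul_add, smul_mul_assoc, mul_smul_comm, smul_sub]
      abel
    simp only [RingHom.mapMatrix_apply, Matrix.map_apply, Matrix.of_apply, coe_evalRingHom,
      eval_add, eval_mul, eval_C, eval_X]
    rw [this, map_add, map_smul, smul_eq_mul]
  have hPQ : P * Q = 0 := by
    refine Polynomial.funext fun t => ?_
    rw [eval_mul, eval_zero, mul_eq_zero, or_iff_not_imp_right]
    intro hne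
    rw [hQ] at hne
    rw [hP]
    exact det_eq_zero_of_finrank_range_lt (LinearMap.mulLeft ℂ (g t) - LinearMap.mulRight ℂ (g t))
      ((finrank_range_commutator_le (g t) _ hne).trans_lt hq) φ y
  have hQ0 : Q ≠ 0 := by
    intro h0
    have h1 := hQ 1
    have hg : g 1 = d := by simp [g]
    have hv : (Matrix.of fun i j : Fin n => ((d ^ (j : ℕ)).mulVec fun _ => 1) i) =
        Matrix.vandermonde fun i : Fin n => ((i : ℕ) : ℂ) := by
      ext i j
      simp [d, Matrix.diagonal_pow, Matrix.mulVec_diagonal, Matrix.vandermonde_apply]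
    rw [h0, eval_zero, hg, hv] at h1
    refine Matrix.det_vandermonde_ne_zero_iff.2 ?_ h1.symm
    intro i j hij
    exact Fin.ext (Nat.cast_injective hij)
  have hP0 := hP 0
  rw [(mul_eq_zero.1 hPQ).resolve_right hQ0, eval_zero] at hP0
  simpa [g] using hP0.symm

end Commutator

/-! ### The upper bound for `𝔰𝔩_n` -/

section Bounds

attribute [local instance 100] LieRing.ofAssociativeRing

theorem not_degenerates_lieStructureTensor_sl {n k q : ℕ} (hk : 2 ≤ k) (hq : n ^ 2 - n < q) :
    ¬ Degenerates (lieStructureTensor (SL n) k) (unitTensor (Fin (k + 1)) q) := by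
  refine not_degenerates_of_det_eq_zero _ hk fun z φ y => ?_
  -- Extending the forms to all matrices reduces the claim to the commutator on `𝔤𝔩_n`.
  choose Φ hΦ using fun i => LinearMap.exists_extend
    (p := (LieAlgebra.SpecialLinear.sl (Fin n) ℂ).toSubmodule) (φ i)
  rw [← det_commutator_eq_zero hq z.val Φ fun j => (y j).val]
  congr 1
  ext i j
  exact (LinearMap.congr_fun (hΦ i) ⁅z, y j⁆).symm

theorem borderSubrank_lieStructureTensor_sl_le {n k : ℕ} (hk : 2 ≤ k) :
    borderSubrank (lieStructureTensor (SL n) k) ≤ ((n ^ 2 - n : ℕ) : ℕ∞) := by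
  refine iSup₂_le fun q hq => ?_
  by_contra! h
  exact not_degenerates_lieStructureTensor_sl hk (by exact_mod_cast h) hq

end Bounds

/-! ### Inductive degeneration to two constant multi-indices -/

section Diagonal

variable {A : Type*} [AddCommGroup A] [Module ℂ A]

/-- The family supported on the two constant multi-indices, with values `e` and `v`. -/
def diagonalValues (e v : A) (k : ℕ) : (Fin k → Fin 2) → A :=
  fun j => if ∀ l, j l = 0 then e else if ∀ l, j l = 1 then v else 0

theorem smul_mem_valueSet {k q : ℕ} (m : MultilinearMap ℂ (fun _ : Fin k => A) A)
    (s : Fin k → Fin q → ℂ) {Z : (Fin k → Fin q) → A} (hZ : Z ∈ valueSet q m) :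
    (fun j => (∏ l, s l (j l)) • Z j) ∈ valueSet q m := by
  obtain ⟨x, rfl⟩ := hZ
  exact ⟨fun l p => s l p • x l p, funext fun j => m.map_smul_univ _ _⟩

theorem mul_mem_valueSet (mul : A →ₗ[ℂ] A →ₗ[ℂ] A) {k q : ℕ} (y : Fin q → A)
    {Z : (Fin (k + 1) → Fin q) → A} (hZ : Z ∈ valueSet q (iteratedProduct mul (k + 1))) :
    (fun j => mul (Z (Fin.init j)) (y (j (Fin.last _)))) ∈
      valueSet q (iteratedProduct mul (k + 2)) := by
  obtain ⟨x, rfl⟩ := hZ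
  refine ⟨Fin.snoc x y, funext fun j => ?_⟩
  change mul (iteratedProduct mul (k + 1) _) _ = _
  simp [Fin.init_def, Fin.init]

variable [TopologicalSpace A] [IsModuleTopology ℂ A]

/-- One step of the iterated product, followed by rescaling of the vectors with index `1` in the
first and in the last slot. -/
theorem smul_mul_mem_closure_valueSet (mul : A →ₗ[ℂ] A →ₗ[ℂ] A) {k : ℕ} (y : Fin 2 → A) (α β : ℂ)
    {Z : (Fin (k + 1) → Fin 2) → A}
    (hZ : Z ∈ closure (valueSet 2 (iteratedProduct mul (k + 1)))) :
    (fun j : Fin (k + 2) → Fin 2 => ((if j 0 = 0 then 1 else α) *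
      (if j (Fin.last _) = 0 then 1 else β)) • mul (Z (Fin.init j)) (y (j (Fin.last _)))) ∈
      closure (valueSet 2 (iteratedProduct mul (k + 2))) := by
  let c (j : Fin (k + 2) → Fin 2) : ℂ :=
    (if j 0 = 0 then 1 else α) * (if j (Fin.last _) = 0 then 1 else β)
  let F : ((Fin (k + 1) → Fin 2) → A) →ₗ[ℂ] ((Fin (k + 2) → Fin 2) → A) :=
    LinearMap.pi fun j => c j • (mul.flip (y (j (Fin.last _))) ∘ₗ LinearMap.proj (Fin.init j))
  have hadd : ContinuousAdd A := IsModuleTopology.toContinuousAdd ℂ A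
  have hF : Continuous F := IsModuleTopology.continuous_of_linearMap F
  refine map_mem_closure hF hZ fun Z hZ => ?_
  let s : Fin (k + 2) → Fin 2 → ℂ := Fin.cons (fun p => if p = 0 then 1 else α)
    (Fin.snoc (fun _ _ => 1) fun p => if p = 0 then 1 else β : Fin (k + 1) → Fin 2 → ℂ)
  convert smul_mem_valueSet _ s (mul_mem_valueSet mul y hZ) using 1
  funext j
  have hs : ∏ l, s l (j l) = c j := by
    rw [Fin.prod_univ_succ, Fin.prod_univ_castSucc]
    simp [s, c]
  rw [hs]
  rfl

theorem mem_of_forall_ne_zero_add_smul_mem {E : Type*} [AddCommGroup E] [Module ℂ E]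
    [TopologicalSpace E] [IsModuleTopology ℂ E] {S : Set E} (hS : IsClosed S) (p g : E)
    (h : ∀ t : ℂ, t ≠ 0 → p + t • g ∈ S) : p ∈ S := by
  have hadd : ContinuousAdd E := IsModuleTopology.toContinuousAdd ℂ E
  have hc : Continuous fun t : ℂ => p + t • g := by fun_prop
  have hd : (0 : ℂ) ∈ closure {t | t ≠ 0} := (dense_compl_singleton (0 : ℂ)) 0
  have h0 : p + (0 : ℂ) • g ∈ S := closure_minimal (fun t ht => h t ht) (hS.preimage hc) hd
  rwa [zero_smul, add_zero] at h0

/-- Putting `a`, `b` in the new last slot gives the wanted values `e`, `v'` and two mixed entries,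
`mul e b` and `mul v a`. By `h` one of these is zero, and the other can be scaled away. -/
theorem diagonalValues_mem_closure_succ (mul : A →ₗ[ℂ] A →ₗ[ℂ] A) {k : ℕ} {e v v' a b : A}
    (hea : mul e a = e) (hvb : mul v b = v') (h : mul e b = 0 ∨ mul v a = 0)
    (hZ : diagonalValues e v (k + 1) ∈ closure (valueSet 2 (iteratedProduct mul (k + 1)))) :
    diagonalValues e v' (k + 2) ∈ closure (valueSet 2 (iteratedProduct mul (k + 2))) := by
  refine mem_of_forall_ne_zero_add_smul_mem isClosed_closure _
    (fun j => if ∀ l, Fin.init j l = 0 then if j (Fin.last _) = 0 then 0 else mul e b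
      else if ∀ l, Fin.init j l = 1 then if j (Fin.last _) = 0 then mul v a else 0
      else 0) fun t ht => ?_
  -- The entry at all ones is scaled by `α * β`, the mixed entries by `α` and `β` separately. The
  -- surviving mixed entry gets the factor `t`; the factor `t⁻¹` falls on the one that is zero.
  obtain ⟨α, β, hαβ, hα, hβ⟩ : ∃ α β : ℂ, α * β = 1 ∧ α • mul v a = t • mul v a ∧
      β • mul e b = t • mul e b := by
    rcases h with h | h
    · exact ⟨t, t⁻¹, mul_inv_cancel₀ ht, rfl, by simp [h]⟩
    · exact ⟨t⁻¹, t, inv_mul_cancel₀ ht, by simp [h], rfl⟩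
  convert smul_mul_mem_closure_valueSet mul ![a, b] α β hZ using 1
  funext j
  have hj (p : Fin 2) : (∀ l, j l = p) ↔ (∀ l, Fin.init j l = p) ∧ j (Fin.last _) = p :=
    Fin.forall_fin_succ'
  have h0 (p : Fin 2) (hp : ∀ l, Fin.init j l = p) : j 0 = p := hp 0
  simp only [Pi.add_apply, Pi.smul_apply, diagonalValues, hj]
  have hlast : j (Fin.last _) = 0 ∨ j (Fin.last _) = 1 := by
    generalize j (Fin.last _) = p
    fin_cases p <;> simp
  by_cases H0 : ∀ l, Fin.init j l = 0
  · rcases hlast with hl | hl <;> simp [H0, hl, h0 0 H0, hea, hβ]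
  · by_cases H1 : ∀ l, Fin.init j l = 1
    · rcases hlast with hl | hl <;> simp [H1, hl, h0 1 H1, hvb, hα, hαβ]
    · simp only [H0, H1, false_and, if_false]
      simp

/-- The second value alternates: `b` takes `f` to `h` and kills `e`, while `c` takes `h` back to `f`
and `a` kills `h`. Either way one mixed product is zero. -/
theorem diagonalValues_mem_closure (mul : A →ₗ[ℂ] A →ₗ[ℂ] A) {e f h a b c : A}
    (hea : mul e a = e) (hha : mul h a = 0) (heb : mul e b = 0) (hfb : mul f b = h)
    (hhc : mul h c = f) (k : ℕ) :
    diagonalValues e f (k + 1) ∈ closure (valueSet 2 (iteratedProduct mul (k + 1))) ∨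
      diagonalValues e h (k + 1) ∈ closure (valueSet 2 (iteratedProduct mul (k + 1))) := by
  induction k with
  | zero =>
    refine Or.inl (subset_closure ⟨fun _ => ![e, f], funext fun j => ?_⟩)
    change ![e, f] (j 0) = _
    generalize hp : j 0 = p
    fin_cases p <;> simp [diagonalValues, hp]
  | succ k ih =>
    rcases ih with ih | ih
    · exact Or.inr (diagonalValues_mem_closure_succ mul hea hfb (Or.inl heb) ih)
    · exact Or.inl (diagonalValues_mem_closure_succ mul hea hhc (Or.inr hha) ih)

theorem degenerates_of_diagonalValues [FiniteDimensional ℂ A] {k : ℕ}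
    (m : MultilinearMap ℂ (fun _ : Fin (k + 1) => A) A) {e v : A} {φ ψ : Module.Dual ℂ A}
    (hφe : φ e = 1) (hφv : φ v = 0) (hψe : ψ e = 0) (hψv : ψ v = 1)
    (h : diagonalValues e v (k + 1) ∈ closure (valueSet 2 m)) :
    Degenerates (tensorOf m) (unitTensor (Fin (k + 1 + 1)) 2) := by
  refine degenerates_unitTensor m ![φ, ψ] h fun i j => ?_
  have hne (h0 : ∀ l, j l = 0) : ¬ ∀ l, j l = 1 := fun h1 => by
    simpa [h0 0] using h1 0
  unfold diagonalValues
  by_cases h0 : ∀ l, j l = 0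
  · fin_cases i <;> simp [h0, hφe, hψe]
  · by_cases h1 : ∀ l, j l = 1
    · fin_cases i <;> simp [h1, hφv, hψv]
    · fin_cases i <;> simp only [if_neg h0, if_neg h1, map_zero] <;> simp [h0, h1]

end Diagonal

/-! ### Explicit elements of `𝔰𝔩_2` and `𝔰𝔩_n` -/

section SpecialLinear

attribute [local instance 100] LieRing.ofAssociativeRing

/-- The `(i, j)` matrix entry as a linear form on `𝔰𝔩_n`. -/
def entryForm {n : ℕ} (i j : Fin n) : Module.Dual ℂ (SL n) :=
  Matrix.entryLinearMap ℂ ℂ i j ∘ₗ (LieAlgebra.SpecialLinear.sl (Fin n) ℂ).toSubmodule.subtype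

theorem entryForm_apply {n : ℕ} (i j : Fin n) (x : SL n) : entryForm i j x = x.val i j := rfl

open LieAlgebra.SpecialLinear in
theorem degenerates_lieStructureTensor_sl_two (k : ℕ) :
    Degenerates (lieStructureTensor (SL 2) (k + 1)) (unitTensor (Fin (k + 1 + 1)) 2) := by
  let _ : TopologicalSpace (SL 2) := moduleTopology ℂ (SL 2)
  have : IsModuleTopology ℂ (SL 2) := ⟨rfl⟩
  let e : SL 2 := single 0 1 (by decide) 1
  let f : SL 2 := single 1 0 (by decide) 1
  let h : SL 2 := singleSubSingle 0 1 1
  have hea : ⁅e, (-1 / 2 : ℂ) • h⁆ = e := by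
    ext i j
    fin_cases i <;> fin_cases j <;> simp [e, h, Ring.lie_def, Matrix.mul_apply, Matrix.single_apply]
    norm_num
  have hha : ⁅h, (-1 / 2 : ℂ) • h⁆ = 0 := by simp
  have heb : ⁅e, -e⁆ = 0 := by simp
  have hfb : ⁅f, -e⁆ = h := by
    ext i j
    fin_cases i <;> fin_cases j <;> simp [e, f, h, Ring.lie_def]
  have hhc : ⁅h, (-1 / 2 : ℂ) • f⁆ = f := by
    ext i j
    fin_cases i <;> fin_cases j <;> simp [f, h, Ring.lie_def, Matrix.mul_apply, Matrix.single_apply]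
    norm_num
  rcases diagonalValues_mem_closure (LieAlgebra.ad ℂ (SL 2) : SL 2 →ₗ[ℂ] SL 2 →ₗ[ℂ] SL 2)
    hea hha heb hfb hhc k with H | H
  · exact degenerates_of_diagonalValues _ (φ := entryForm 0 1) (ψ := entryForm 1 0)
      (by simp [e, entryForm_apply]) (by simp [f, entryForm_apply])
      (by simp [e, entryForm_apply]) (by simp [f, entryForm_apply]) H
  · exact degenerates_of_diagonalValues _ (φ := entryForm 0 1) (ψ := entryForm 0 0)
      (by simp [e, entryForm_apply]) (by simp [h, entryForm_apply])
      (by simp [e, entryForm_apply]) (by simp [h, entryForm_apply]) H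

open LieAlgebra.SpecialLinear in
theorem restricts_lieStructureTensor_sl (n : ℕ) :
    Restricts (lieStructureTensor (SL (n + 2)) 2) (unitTensor (Fin 3) (n + 2)) := by
  let r : Fin (n + 2) := Fin.last (n + 1)
  have hr : r ≠ 0 := Fin.last_pos.ne'
  let d (k : Fin (n + 2)) : SL (n + 2) := ⟨((n + 2 : ℂ)⁻¹) • 1 - Matrix.single k k 1, by
    have : (n + 2 : ℂ) ≠ 0 := by exact_mod_cast (n + 1).succ_ne_zero
    change Matrix.trace (((n + 2 : ℂ)⁻¹) • (1 : Matrix (Fin (n + 2)) (Fin (n + 2)) ℂ) -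
      Matrix.single k k 1) = 0
    simp [this]⟩
  -- For `p, s ≠ r`, `[E_pr, d_s]` is `E_pr` if `p = s` and zero otherwise. Also `[E_r0, E_0r] =
  -- E_rr - E_00` and `[E_pr, E_0r] = 0`, while `[E_r0, d_s]` lies in column `0`, which the entries
  -- `(i, r)` do not see.
  let x (j : Fin (n + 2)) : SL (n + 2) :=
    if hj : j = r then single r 0 hr 1 else single j r hj 1
  let y (j : Fin (n + 2)) : SL (n + 2) :=
    if j = r then single 0 r hr.symm 1 else d j
  refine restricts_unitTensor _ (fun i => entryForm i r) ![x, y] fun i j => ?_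
  change ((x (j 0)).val * (y (j 1)).val - (y (j 1)).val * (x (j 0)).val) i r = _
  simp only [Fin.forall_fin_two]
  generalize j 0 = p
  generalize j 1 = s
  by_cases hp : p = r <;> by_cases hs : s = r
  · simp [x, y, hp, hs, Matrix.single_apply, hr, eq_comm]
  · simp [x, y, d, hp, hs, mul_sub, sub_mul, Matrix.mul_apply, Matrix.single_apply, hr.symm]
    exact fun h h' => hs (h'.trans h.symm)
  · simp [x, y, hp, hs, Matrix.mul_apply, Matrix.single_apply, hr]
    rw [if_neg fun h => hp h.2.symm, if_neg fun h => hp (h.1.trans h.2.symm), neg_zero]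
  · simp [x, y, d, hp, hs, mul_sub, sub_mul, Matrix.mul_apply, Matrix.single_apply]
    congr 1
    grind

end SpecialLinear

end TensorSubrank

end

theorem mainTheorem8 :
    (∀ n : ℕ, 2 ≤ n →
      (n : ℕ∞) ≤ TensorSubrank.subrank
          (TensorSubrank.lieStructureTensor (TensorSubrank.SL n) 2) ∧
        TensorSubrank.subrank (TensorSubrank.lieStructureTensor (TensorSubrank.SL n) 2) ≤
          TensorSubrank.borderSubrank
            (TensorSubrank.lieStructureTensor (TensorSubrank.SL n) 2) ∧
        TensorSubrank.borderSubrank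
            (TensorSubrank.lieStructureTensor (TensorSubrank.SL n) 2) ≤
          ((n ^ 2 - n : ℕ) : ℕ∞)) ∧
      ∀ k : ℕ, 2 ≤ k →
        TensorSubrank.borderSubrank
          (TensorSubrank.lieStructureTensor (TensorSubrank.SL 2) k) = 2 := by
  refine ⟨fun n hn => ⟨?_, TensorSubrank.subrank_le_borderSubrank _,
    TensorSubrank.borderSubrank_lieStructureTensor_sl_le le_rfl⟩, fun k hk => le_antisymm ?_ ?_⟩
  · obtain ⟨n, rfl⟩ := Nat.exists_eq_add_of_le' hn
    exact le_iSup₂ (f := fun (q : ℕ) _ => (q : ℕ∞)) (n + 2)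
      (TensorSubrank.restricts_lieStructureTensor_sl n)
  -- The general bound is sharp here, as `2 ^ 2 - 2 = 2`.
  · exact TensorSubrank.borderSubrank_lieStructureTensor_sl_le (n := 2) hk
  · obtain ⟨k, rfl⟩ := Nat.exists_eq_add_of_le' hk
    exact le_iSup₂ (f := fun (q : ℕ) _ => (q : ℕ∞)) 2
      (TensorSubrank.degenerates_lieStructureTensor_sl_two (k + 1))
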